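/- Let $\mathcal F$ be the class of functions $h$ analytic and locally univalent (i.e. $h'\neq 0$) in the unit disk $\mathbb D=\{z\in\mathbb C:|z|<1\}$ with $h(0)=0$, $h'(0)=1$ and $$\mathrm{Re}\Big(1+\frac{zh''(z)}{h'(z)}\Big)>-\frac12\qquad (z\in\mathbb D).$$ For $\beta>0$, $r\in(0,1)$ and $h\in\mathcal F$ put $$I_\beta(r,h)=\frac1{2\pi}\int_{-\pi}^{\pi}\frac{d\theta}{|h'(re^{i\theta})|^{2\beta}}.$$ Then for every $h\in\mathcal F$, $\beta>0$ and $r\in(0,1)$ the integral exists and $$I_\beta(r,h)\le \frac{2^{6\beta}}{\pi}\,B\Big(\frac{6\beta+1}{2},\frac12\Big),$$ where $B$ is the Euler beta function. The inequality is sharp: for every $\beta>0$ the right-hand side is the supremum of $I_\beta(r,h)$ over all $h\in\mathcal F$ and $r\in(0,1)$. It is approached by the function $$h_0(z)=\frac{z-z^2/2}{(1-z)^2},$$ which belongs to $\mathcal F$, is univalent in $\mathbb D$ and satisfies $h_0'(z)=(1-z)^{-3}$ for $z\in\mathbb D$: for every $\beta>0$, $$\lim_{r\to1^-}I_\beta(r,h_0)=\frac{2^{6\beta}}{\pi}\,B\Big(\frac{6\beta+1}{2},\frac12\Big).$$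 -/

import Mathlib

open Filter Topology

/-- The class `𝒜`: functions `h` analytic in the open unit disk, with `h 0 = 0` and `h' 0 = 1`.
Only the values of `h` in the disk matter. -/
def classA : Set (ℂ → ℂ) :=
  {h | AnalyticOnNhd ℂ h (Metric.ball 0 1) ∧ h 0 = 0 ∧ deriv h 0 = 1}

/-- The class `𝒮`: functions of the class `𝒜` that are univalent (injective) in the unit disk. -/
def classS : Set (ℂ → ℂ) :=
  {h | h ∈ classA ∧ Set.InjOn h (Metric.ball 0 1)}

/-- The class `𝒦(α)`: locally univalent functions `h` of the class `𝒜` (that is, `h'` has no zero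
in the unit disk) with `Re (1 + z h''(z) / h'(z)) > α` in the unit disk. -/
def classK (α : ℝ) : Set (ℂ → ℂ) :=
  {h | h ∈ classA ∧ ∀ z ∈ Metric.ball (0 : ℂ) 1,
    deriv h z ≠ 0 ∧ α < (1 + z * deriv (deriv h) z / deriv h z).re}

/-- The class `ℱ = 𝒦(-1/2)`. -/
def classF : Set (ℂ → ℂ) := classK (-1 / 2)

/-- The integrand `θ ↦ 1 / |h'(r e^{iθ})|^{2β}`. -/
noncomputable def meanIntegrand (β r : ℝ) (h : ℂ → ℂ) (θ : ℝ) : ℝ :=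
  1 / ‖deriv h (r * Complex.exp (θ * Complex.I))‖ ^ (2 * β)

/-- The integral mean `I_β(r, h) = (1 / 2π) ∫_{-π}^{π} dθ / |h'(r e^{iθ})|^{2β}`. -/
noncomputable def integralMean (β r : ℝ) (h : ℂ → ℂ) : ℝ :=
  1 / (2 * Real.pi) * ∫ θ in (-Real.pi)..Real.pi, meanIntegrand β r h θ

/-- The constant `(2^{6β} / π) B((6β + 1) / 2, 1 / 2)`, where `B` is the Euler beta function. -/
noncomputable def sharpConst (β : ℝ) : ℝ :=
  (2 : ℝ) ^ (6 * β) / Real.pi * ProbabilityTheory.beta ((6 * β + 1) / 2) (1 / 2)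

/-- The function `h₀(z) = (z - z² / 2) / (1 - z)²`. -/
noncomputable def extremalFun (z : ℂ) : ℂ := (z - z ^ 2 / 2) / (1 - z) ^ 2

/-!
For `h ∈ 𝒦(α)` put `c = 2 * (1 - α)` and `ω = 1 - (h') ^ (-1 / c)`, with the branch for which
`ω 0 = 0`. Then `z * ω' / (1 - ω) = c⁻¹ * (z * h'' / h')` has real part greater than `-1 / 2` in the
disk. If `ω` left the unit disk, then at a point `z₀` of least modulus with `1 ≤ ‖ω z₀‖` Jack's
lemma would give `z₀ * ω' z₀ = k * ω z₀` with `1 ≤ k`, and since `Re (w / (1 - w)) ≤ -1 / 2` for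
`1 ≤ ‖w‖`, that real part would be at most `-1 / 2`. So `ω` is a Schwarz function, and
`‖h'‖ = ‖1 - ω‖ ^ (-c)`.

Littlewood's subordination principle now bounds the means of `‖1 - ω‖ ^ p` over smaller circles by
the mean of `‖1 - z‖ ^ p` over the unit circle: the Poisson integral of the boundary values of `‖f‖`
is the real part of a holomorphic `H` with `‖f‖ ≤ Re H`, and the mean of `Re (H ∘ ω)` is `Re (H 0)`
by the mean value property. The substitution `x = sin (θ / 2) ^ 2` turns the bound into a beta
integral. For `h₀` the function `ω` is the identity, which gives equality as `r → 1`.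
-/

section Subordination

open Metric

theorem re_div_one_sub {w : ℂ} (hw : w ≠ 1) :
    (w / (1 - w)).re = (1 - ‖w‖ ^ 2) / (2 * ‖1 - w‖ ^ 2) - 1 / 2 := by
  have hne : Complex.normSq (1 - w) ≠ 0 := by
    rwa [Ne, map_eq_zero, sub_eq_zero, eq_comm]
  rw [Complex.div_re, ← add_div, Complex.sq_norm, Complex.sq_norm]
  field_simp
  simp only [Complex.normSq_apply, Complex.sub_re, Complex.sub_im, Complex.one_re, Complex.one_im]
  ring

theorem nonneg_of_hasDerivAt_of_eventually_nonneg {φ : ℝ → ℝ} {φ' x : ℝ} (hφ : HasDerivAt φ φ' x)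
    (hx : φ x = 0) (hpos : ∀ᶠ t in 𝓝[>] 0, 0 ≤ φ (x + t)) : 0 ≤ φ' := by
  refine ge_of_tendsto hφ.tendsto_slope_zero_right ?_
  filter_upwards [hpos, self_mem_nhdsWithin] with t ht (ht0 : 0 < t)
  rw [hx, sub_zero]
  positivity

theorem re_le_re_mul_of_hasDerivAt_one {g : ℂ → ℂ} {c : ℂ} (hg : HasDerivAt g c 1) (hg1 : g 1 = 1)
    (hle : ∀ z ∈ ball (0 : ℂ) 1, (g z).re ≤ ‖z‖) {d : ℂ} (hd : 0 < d.re) :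
    d.re ≤ (c * d).re := by
  have hnorm (t : ℝ) : ‖1 - t * d‖ ^ 2 = 1 - 2 * d.re * t + ‖d‖ ^ 2 * t ^ 2 := by
    simp only [Complex.sq_norm, Complex.normSq_apply, Complex.sub_re, Complex.sub_im,
      Complex.re_ofReal_mul, Complex.im_ofReal_mul, Complex.one_re, Complex.one_im]
    ring
  have hline : HasDerivAt (fun t : ℝ => 1 - t * d) (-d) 0 := by
    simpa using ((Complex.ofRealCLM.hasDerivAt (x := 0)).mul_const d).const_sub 1
  have hre : HasDerivAt (fun t : ℝ => (g (1 - t * d)).re) (c * -d).re 0 :=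
    Complex.reCLM.hasFDerivAt.comp_hasDerivAt 0 (hg.comp_of_eq 0 hline (by simp))
  have hsq : HasDerivAt (fun t : ℝ => (1 + ‖1 - t * d‖ ^ 2) / 2) (-d.re) 0 := by
    have h := (((hasDerivAt_id (0 : ℝ)).const_mul (2 * d.re)).const_sub 1).add
      (((hasDerivAt_id (0 : ℝ)).pow 2).const_mul (‖d‖ ^ 2))
    simp only [hnorm]
    exact ((h.const_add 1).div_const 2).congr_deriv (by simp; ring)
  have hnonneg := nonneg_of_hasDerivAt_of_eventually_nonneg (hsq.sub hre) (by simp [hg1]) ?_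
  · simp only [mul_neg, Complex.neg_re] at hnonneg
    linarith
  -- `‖1 - t * d‖ ≤ (1 + ‖1 - t * d‖ ^ 2) / 2`, and both sides have the same derivative at `t = 0`.
  have hsmall : ∀ᶠ t in 𝓝[>] (0 : ℝ), ‖d‖ ^ 2 * t < 2 * d.re := by
    refine nhdsWithin_le_nhds (ContinuousAt.eventually_lt (by fun_prop) continuousAt_const ?_)
    simpa using hd
  filter_upwards [hsmall, self_mem_nhdsWithin] with t ht (ht0 : 0 < t)
  have hlt : ‖1 - t * d‖ < 1 := by
    rw [← sq_lt_one_iff₀ (norm_nonneg _), hnorm]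
    nlinarith
  have hg' := hle (1 - t * d) (by simpa using hlt)
  simp only [zero_add, Pi.sub_apply]
  linarith [two_mul_le_add_sq 1 ‖1 - t * d‖]

theorem exists_ofReal_eq_of_hasDerivAt_one {g : ℂ → ℂ} {c : ℂ} (hg : HasDerivAt g c 1)
    (hg1 : g 1 = 1) (hle : ∀ z ∈ ball (0 : ℂ) 1, (g z).re ≤ ‖z‖) :
    ∃ k : ℝ, 1 ≤ k ∧ c = k := by
  have hdir (s : ℝ) : 1 ≤ c.re - c.im * s := by
    simpa using re_le_re_mul_of_hasDerivAt_one hg hg1 hle (d := ⟨1, s⟩) one_pos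
  have him : c.im = 0 := by
    by_contra hne
    have h := hdir (c.re / c.im)
    rw [mul_div_cancel₀ _ hne] at h
    linarith
  exact ⟨c.re, by simpa using hdir 0, Complex.ext rfl him⟩

theorem jack_lemma {f : ℂ → ℂ} {z₀ : ℂ} (hf : DifferentiableOn ℂ f (ball 0 ‖z₀‖))
    (hf₀ : DifferentiableAt ℂ f z₀) (hzero : f 0 = 0) (hmax : ∀ z ∈ ball 0 ‖z₀‖, ‖f z‖ ≤ ‖f z₀‖)
    (hne : f z₀ ≠ 0) : ∃ k : ℝ, 1 ≤ k ∧ z₀ * deriv f z₀ = k * f z₀ := by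
  have hz₀ : z₀ ≠ 0 := by rintro rfl; exact hne hzero
  have hderiv : HasDerivAt (fun ζ => f (ζ * z₀) / f z₀) (deriv f z₀ * z₀ / f z₀) 1 := by
    have hmul : HasDerivAt (fun ζ : ℂ => ζ * z₀) z₀ 1 := by
      simpa using (hasDerivAt_id (1 : ℂ)).mul_const z₀
    exact (hf₀.hasDerivAt.comp_of_eq 1 hmul (one_mul z₀).symm).div_const _
  suffices hle : ∀ ζ ∈ ball (0 : ℂ) 1, (f (ζ * z₀) / f z₀).re ≤ ‖ζ‖ by
    obtain ⟨k, hk, hck⟩ := exists_ofReal_eq_of_hasDerivAt_one hderiv (by simp [hne]) hle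
    exact ⟨k, hk, by rw [← hck]; field_simp⟩
  intro ζ hζ
  have hmem : ζ * z₀ ∈ ball 0 ‖z₀‖ := by
    have : 0 < ‖z₀‖ := norm_pos_iff.2 hz₀
    have : ‖ζ‖ < 1 := by simpa using hζ
    rw [mem_ball_zero_iff, norm_mul]
    nlinarith
  have hschwarz := Complex.dist_le_div_mul_dist_of_mapsTo_ball hf
    (fun z hz => by simpa [hzero] using hmax z hz) hmem
  refine (Complex.re_le_norm _).trans ?_
  rw [norm_div, div_le_iff₀ (norm_pos_iff.2 hne)]
  rw [dist_eq_norm, dist_eq_norm, hzero, sub_zero, sub_zero, norm_mul] at hschwarz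
  refine hschwarz.trans_eq ?_
  have : ‖z₀‖ ≠ 0 := norm_ne_zero_iff.2 hz₀
  field_simp

theorem exists_forall_norm_lt_of_le_norm {E F : Type*} [SeminormedAddCommGroup E] [ProperSpace E]
    [SeminormedAddCommGroup F] {f : E → F} {R a : ℝ} (hf : ContinuousOn f (ball 0 R))
    (hex : ∃ z ∈ ball 0 R, a ≤ ‖f z‖) :
    ∃ z₀ ∈ ball 0 R, a ≤ ‖f z₀‖ ∧ ∀ z ∈ ball 0 ‖z₀‖, ‖f z‖ < a := by
  obtain ⟨z₁, hz₁, haz₁⟩ := hex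
  have hsub : closedBall (0 : E) ‖z₁‖ ⊆ ball 0 R := closedBall_subset_ball (by simpa using hz₁)
  have hcompact : IsCompact (closedBall 0 ‖z₁‖ ∩ {z | a ≤ ‖f z‖}) := by
    refine (isCompact_closedBall 0 ‖z₁‖).of_isClosed_subset ?_ Set.inter_subset_left
    exact (hf.mono hsub).norm.preimage_isClosed_of_isClosed isClosed_closedBall isClosed_Ici
  obtain ⟨z₀, ⟨hz₀, haz₀⟩, hmin⟩ :=
    hcompact.exists_isMinOn ⟨z₁, by simp, haz₁⟩ continuous_norm.continuousOn
  refine ⟨z₀, hsub hz₀, haz₀, fun z hz => ?_⟩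
  by_contra! haz
  have hz' : ‖z‖ < ‖z₀‖ := by simpa using hz
  have hz₀' : ‖z₀‖ ≤ ‖z₁‖ := by simpa using hz₀
  exact hz'.not_ge (hmin ⟨by simpa using hz'.le.trans hz₀', haz⟩)

theorem mapsTo_ball_of_neg_half_lt_re {ω : ℂ → ℂ} {R : ℝ} (hω : DifferentiableOn ℂ ω (ball 0 R))
    (hzero : ω 0 = 0) (hone : ∀ z ∈ ball 0 R, ω z ≠ 1)
    (hre : ∀ z ∈ ball 0 R, -1 / 2 < (z * deriv ω z / (1 - ω z)).re) :
    Set.MapsTo ω (ball 0 R) (ball 0 1) := by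
  by_contra! hmaps
  obtain ⟨z₀, hz₀, hz₀_le, hlt⟩ := exists_forall_norm_lt_of_le_norm (a := 1) hω.continuousOn
    (by simpa [Set.MapsTo] using hmaps)
  have hsub : ball (0 : ℂ) ‖z₀‖ ⊆ ball 0 R :=
    ball_subset_ball (mem_ball_zero_iff.1 hz₀).le
  obtain ⟨k, hk, hjack⟩ := jack_lemma (hω.mono hsub)
    (hω.differentiableAt (isOpen_ball.mem_nhds hz₀)) hzero
    (fun z hz => ((hlt z hz).trans_le hz₀_le).le) (norm_pos_iff.1 (one_pos.trans_le hz₀_le))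
  have hre₀ := hre z₀ hz₀
  have hpos : 0 < ‖1 - ω z₀‖ := norm_pos_iff.2 (sub_ne_zero.2 (hone z₀ hz₀).symm)
  have hquot : (1 - ‖ω z₀‖ ^ 2) / (2 * ‖1 - ω z₀‖ ^ 2) ≤ 0 :=
    div_nonpos_of_nonpos_of_nonneg (by nlinarith) (by positivity)
  rw [hjack, mul_div_assoc, Complex.re_ofReal_mul, re_div_one_sub (hone z₀ hz₀)] at hre₀
  nlinarith

theorem exists_hasDerivAt_exp_eq {f : ℂ → ℂ} {c : ℂ} {r : ℝ}
    (hf : DifferentiableOn ℂ f (ball c r)) (hne : ∀ z ∈ ball c r, f z ≠ 0) :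
    ∃ g : ℂ → ℂ, g c = Complex.log (f c) ∧
      ∀ z ∈ ball c r, HasDerivAt g (deriv f z / f z) z ∧ Complex.exp (g z) = f z := by
  obtain ⟨g, hgc, hg⟩ :=
    ((hf.deriv isOpen_ball).div hf hne).isExactOn_ball.with_val_at c (Complex.log (f c))
  refine ⟨g, hgc, fun z hz => ⟨hg z hz, ?_⟩⟩
  have hderiv : ∀ w ∈ ball c r, HasDerivAt (fun w => f w * Complex.exp (-g w)) 0 w := fun w hw => by
    have hfw := (hf.differentiableAt (isOpen_ball.mem_nhds hw)).hasDerivAt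
    refine (hfw.mul (hg w hw).neg.cexp).congr_deriv ?_
    have := hne w hw
    simp only [Pi.div_apply]
    field_simp
    ring
  have hc : c ∈ ball c r := mem_ball_self (pos_of_mem_ball hz)
  have hconst := isOpen_ball.is_const_of_deriv_eq_zero (convex_ball c r).isPreconnected
    (fun w hw => (hderiv w hw).differentiableAt.differentiableWithinAt)
    (fun w hw => (hderiv w hw).deriv) hz hc
  simp only [hgc, Complex.exp_neg, Complex.exp_log (hne c hc), mul_inv_cancel₀ (hne c hc)] at hconst
  exact (eq_of_mul_inv_eq_one hconst).symm

/-- The Schwarz functions: holomorphic self-maps of the unit disk that fix the origin. A function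
that factors through a Schwarz function `ω` as `f ∘ ω` is subordinate to `f`. -/
structure IsSchwarzFunction (ω : ℂ → ℂ) : Prop where
  differentiableOn : DifferentiableOn ℂ ω (ball 0 1)
  mapsTo : Set.MapsTo ω (ball 0 1) (ball 0 1)
  map_zero : ω 0 = 0

theorem exists_isSchwarzFunction_norm_eq {f : ℂ → ℂ} {c : ℝ} (hc : 0 < c)
    (hf : DifferentiableOn ℂ f (ball 0 1)) (hf0 : f 0 = 1) (hne : ∀ z ∈ ball (0 : ℂ) 1, f z ≠ 0)
    (hre : ∀ z ∈ ball (0 : ℂ) 1, -c / 2 < (z * deriv f z / f z).re) :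
    ∃ ω, IsSchwarzFunction ω ∧ ∀ z ∈ ball (0 : ℂ) 1, ‖f z‖ = ‖1 - ω z‖ ^ (-c) := by
  obtain ⟨g, hg0, hg⟩ := exists_hasDerivAt_exp_eq hf hne
  have hc0 : (c : ℂ) ≠ 0 := Complex.ofReal_ne_zero.2 hc.ne'
  set ω : ℂ → ℂ := fun z => 1 - Complex.exp (-g z / c) with hω
  have hω_deriv : ∀ z ∈ ball (0 : ℂ) 1,
      HasDerivAt ω (Complex.exp (-g z / c) * (deriv f z / f z / c)) z := fun z hz => by
    refine (((hg z hz).1.neg.div_const (c : ℂ)).cexp.const_sub 1).congr_deriv ?_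
    simp only [Pi.neg_apply]
    ring
  have hω_diff : DifferentiableOn ℂ ω (ball 0 1) := fun z hz =>
    (hω_deriv z hz).differentiableAt.differentiableWithinAt
  have hω_zero : ω 0 = 0 := by simp [hω, hg0, hf0]
  refine ⟨ω, ⟨hω_diff, mapsTo_ball_of_neg_half_lt_re hω_diff hω_zero (fun z _ => ?_)
    fun z hz => ?_, hω_zero⟩, fun z hz => ?_⟩
  · simp [hω, sub_eq_self, Complex.exp_ne_zero]
  · have hquot : z * deriv ω z / (1 - ω z) = z * deriv f z / f z / c := by
      have := Complex.exp_ne_zero (-g z / c)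
      rw [(hω_deriv z hz).deriv, hω, sub_sub_cancel]
      field_simp
    rw [hquot, Complex.div_ofReal_re, lt_div_iff₀ hc]
    linarith [hre z hz]
  · rw [← (hg z hz).2, hω, sub_sub_cancel, Complex.norm_exp, Complex.norm_exp, ← Real.exp_mul,
      Complex.div_ofReal_re, Complex.neg_re, mul_neg, neg_div, neg_mul, neg_neg,
      div_mul_cancel₀ _ hc.ne']

theorem lt_one_of_mem_classK {α : ℝ} {h : ℂ → ℂ} (hh : h ∈ classK α) : α < 1 := by
  simpa using (hh.2 0 (by simp)).2

theorem exists_isSchwarzFunction_norm_deriv_eq {α : ℝ} {h : ℂ → ℂ} (hh : h ∈ classK α) :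
    ∃ ω, IsSchwarzFunction ω ∧
      ∀ z ∈ ball (0 : ℂ) 1, ‖deriv h z‖ = ‖1 - ω z‖ ^ (-(2 * (1 - α))) := by
  refine exists_isSchwarzFunction_norm_eq (by linarith [lt_one_of_mem_classK hh])
    hh.1.1.deriv.differentiableOn hh.1.2.2 (fun z hz => (hh.2 z hz).1) fun z hz => ?_
  have hre := (hh.2 z hz).2
  rw [Complex.add_re, Complex.one_re] at hre
  linarith

end Subordination

section Littlewood

open Metric Real

theorem poissonKernel_nonneg {c w z : ℂ} (h : ‖w - c‖ ≤ ‖z - c‖) : 0 ≤ poissonKernel c w z :=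
  div_nonneg (sub_nonneg.2 (by gcongr)) (by positivity)

theorem norm_circleAverage_le_circleAverage_norm {E : Type*} [NormedAddCommGroup E]
    [NormedSpace ℝ E] (f : ℂ → E) (c : ℂ) (R : ℝ) :
    ‖circleAverage f c R‖ ≤ circleAverage (fun z => ‖f z‖) c R := by
  rw [circleAverage, circleAverage, norm_smul, smul_eq_mul, Real.norm_eq_abs,
    abs_of_pos (inv_pos.2 two_pi_pos)]
  gcongr
  exact intervalIntegral.norm_integral_le_integral_norm two_pi_pos.le

theorem circleAverage_re_of_differentiableOn {f : ℂ → ℂ} {c : ℂ} {R : ℝ}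
    (hf : DifferentiableOn ℂ f (closedBall c |R|)) :
    circleAverage (fun z => (f z).re) c R = (f c).re := by
  have hint : CircleIntegrable f c R :=
    (hf.continuousOn.mono sphere_subset_closedBall).circleIntegrable'
  rw [← (hf.diffContOnCl_ball subset_rfl).circleAverage]
  exact Complex.reCLM.circleAverage_comp_comm hint

variable {E : Type*} [NormedAddCommGroup E] [NormedSpace ℂ E] [CompleteSpace E]

theorem norm_le_circleAverage_poissonKernel_smul_norm {f : ℂ → E} {c w : ℂ} {R : ℝ}
    (hf : DiffContOnCl ℂ f (ball c R)) (hw : w ∈ ball c R) :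
    ‖f w‖ ≤ circleAverage (poissonKernel c w • fun z => ‖f z‖) c R := by
  calc ‖f w‖
      = ‖circleAverage (poissonKernel c w • f) c R‖ := by
        rw [hf.circleAverage_poissonKernel_smul hw]
    _ ≤ circleAverage (fun z => ‖(poissonKernel c w • f) z‖) c R :=
        norm_circleAverage_le_circleAverage_norm _ _ _
    _ = circleAverage (poissonKernel c w • fun z => ‖f z‖) c R := by
        refine circleAverage_congr_sphere fun z hz => ?_
        have hwz : ‖w - c‖ ≤ ‖z - c‖ := by
          rw [mem_sphere_iff_norm.1 hz, abs_of_pos (pos_of_mem_ball hw)]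
          exact (mem_ball_iff_norm.1 hw).le
        simp [norm_smul, abs_of_nonneg (poissonKernel_nonneg hwz)]

theorem exists_differentiableOn_norm_le_re {f : ℂ → E} {R : ℝ} (hR : 0 < R)
    (hf : DiffContOnCl ℂ f (ball 0 R)) :
    ∃ H : ℂ → ℂ, DifferentiableOn ℂ H (ball 0 R) ∧
      (H 0).re = circleAverage (fun z => ‖f z‖) 0 R ∧ ∀ w ∈ ball 0 R, ‖f w‖ ≤ (H w).re := by
  have hcont : ContinuousOn (fun z => ‖f z‖) (sphere 0 |R|) := by
    refine hf.continuousOn.norm.mono ?_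
    rw [abs_of_pos hR, closure_ball 0 hR.ne']
    exact sphere_subset_closedBall
  let H : ℂ → ℂ := fun w =>
    circleAverage (fun ζ => herglotzRieszKernel 0 w ζ • (‖f ζ‖ : ℂ)) 0 R
  have hHre {w : ℂ} (hw : w ∈ ball 0 R) :
      (H w).re = circleAverage (poissonKernel 0 w • fun z => ‖f z‖) 0 R := by
    rw [poissonKernel_eq_re_herglotzRieszKernel]
    exact re_circleAverage_herglotzRieszKernel_smul hcont.circleIntegrable' hw
  refine ⟨H, ?_, ?_, fun w hw => ?_⟩
  · exact differentiableOn_circleAverage_herglotzRieszKernel_smul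
      (Complex.continuous_ofReal.comp_continuousOn hcont).circleIntegrable'
  · rw [hHre (mem_ball_self hR)]
    refine circleAverage_congr_sphere fun z hz => ?_
    have hz0 : z ≠ 0 := by
      rintro rfl
      exact hR.ne (by simpa [abs_of_pos hR] using hz)
    simp [poissonKernel_def, hz0]
  · rw [hHre hw]
    exact norm_le_circleAverage_poissonKernel_smul_norm hf hw

theorem IsSchwarzFunction.circleAverage_norm_comp_le {f : ℂ → E} {ω : ℂ → ℂ} {r : ℝ}
    (hω : IsSchwarzFunction ω) (hf : DiffContOnCl ℂ f (ball 0 1)) (hr : |r| < 1) :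
    circleAverage (fun z => ‖f (ω z)‖) 0 r ≤ circleAverage (fun z => ‖f z‖) 0 1 := by
  have hsub : closedBall (0 : ℂ) |r| ⊆ ball 0 1 := closedBall_subset_ball hr
  have hsphere : sphere (0 : ℂ) |r| ⊆ ball 0 1 := sphere_subset_closedBall.trans hsub
  obtain ⟨H, hH, hH0, hfH⟩ := exists_differentiableOn_norm_le_re one_pos hf
  have hHω : DifferentiableOn ℂ (fun z => H (ω z)) (ball 0 1) :=
    hH.comp hω.differentiableOn hω.mapsTo
  have hfω : ContinuousOn (fun z => f (ω z)) (ball 0 1) :=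
    hf.differentiableOn.continuousOn.comp hω.differentiableOn.continuousOn hω.mapsTo
  calc circleAverage (fun z => ‖f (ω z)‖) 0 r
      ≤ circleAverage (fun z => (H (ω z)).re) 0 r := by
        refine circleAverage_mono (hfω.norm.mono hsphere).circleIntegrable' ?_
          fun z hz => hfH _ (hω.mapsTo (hsphere hz))
        exact (Complex.continuous_re.comp_continuousOn
          (hHω.continuousOn.mono hsphere)).circleIntegrable'
    _ = circleAverage (fun z => ‖f z‖) 0 1 := by
        rw [circleAverage_re_of_differentiableOn (hHω.mono hsub), hω.map_zero, hH0]

theorem one_sub_mem_slitPlane {z : ℂ} (hz : ‖z‖ ≤ 1) (hz1 : z ≠ 1) : 1 - z ∈ Complex.slitPlane := by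
  by_contra hmem
  simp only [Complex.mem_slitPlane_iff, Complex.sub_re, Complex.sub_im, Complex.one_re,
    Complex.one_im, zero_sub, neg_ne_zero, not_or, not_lt, not_not] at hmem
  exact hz1 (Complex.ext (by simp; linarith [Complex.re_le_norm z]) hmem.2)

theorem diffContOnCl_one_sub_cpow {s : ℂ} (hs : 0 < s.re) :
    DiffContOnCl ℂ (fun z : ℂ => (1 - z) ^ s) (ball 0 1) := by
  refine ⟨fun z hz => ?_, fun z hz => ?_⟩
  · have hz' : ‖z‖ < 1 := by simpa using hz
    have hne : z ≠ 1 := by rintro rfl; simp at hz'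
    exact ((differentiableAt_id.const_sub 1).cpow_const
      (one_sub_mem_slitPlane hz'.le hne)).differentiableWithinAt
  · rw [closure_ball _ one_ne_zero, mem_closedBall_zero_iff] at hz
    refine ContinuousAt.continuousWithinAt ?_
    by_cases hne : z = 1
    · exact (Complex.continuousAt_cpow_const_of_re_pos (by simp [hne]) hs).comp
        (f := fun z : ℂ => 1 - z) (by fun_prop)
    · exact ContinuousAt.cpow (by fun_prop) continuousAt_const (one_sub_mem_slitPlane hz hne)

theorem IsSchwarzFunction.circleAverage_norm_one_sub_rpow_le {ω : ℂ → ℂ} {p r : ℝ}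
    (hω : IsSchwarzFunction ω) (hp : 0 < p) (hr : |r| < 1) :
    circleAverage (fun z => ‖1 - ω z‖ ^ p) 0 r ≤ circleAverage (fun z => ‖1 - z‖ ^ p) 0 1 := by
  simpa only [Complex.norm_cpow_real] using
    hω.circleAverage_norm_comp_le (diffContOnCl_one_sub_cpow (s := p) hp) hr

end Littlewood

section BetaIntegral

open Real Set

theorem beta_eq_setIntegral {a b : ℝ} (ha : 0 < a) (hb : 0 < b) :
    ProbabilityTheory.beta a b = ∫ x in Ioo (0 : ℝ) 1, x ^ (a - 1) * (1 - x) ^ (b - 1) := by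
  rw [ProbabilityTheory.beta_eq_betaIntegralReal a b ha hb, Complex.betaIntegral,
    intervalIntegral.integral_of_le zero_le_one, MeasureTheory.integral_Ioc_eq_integral_Ioo,
    ← Complex.ofReal_re (∫ x in Ioo (0 : ℝ) 1, _), ← integral_complex_ofReal]
  congr 1
  refine MeasureTheory.setIntegral_congr_fun measurableSet_Ioo fun x hx => ?_
  have hx1 : 0 ≤ 1 - x := by linarith [hx.2]
  push_cast [Complex.ofReal_cpow hx.1.le, Complex.ofReal_cpow hx1]
  rfl

theorem sin_half_pos {θ : ℝ} (hθ : θ ∈ Ioo 0 π) : 0 < sin (θ / 2) :=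
  sin_pos_of_pos_of_lt_pi (by linarith [hθ.1]) (by linarith [hθ.1, hθ.2])

theorem cos_half_pos {θ : ℝ} (hθ : θ ∈ Ioo 0 π) : 0 < cos (θ / 2) :=
  cos_pos_of_mem_Ioo ⟨by linarith [hθ.1, pi_pos], by linarith [hθ.2]⟩

theorem bijOn_sin_half_sq : BijOn (fun θ : ℝ => sin (θ / 2) ^ 2) (Ioo 0 π) (Ioo 0 1) := by
  refine ⟨fun θ hθ => ?_, fun a ha b hb hab => ?_, fun x hx => ?_⟩
  · have hs := sin_half_pos hθ
    have hc := cos_half_pos hθ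
    have := sin_sq_add_cos_sq (θ / 2)
    exact ⟨by positivity, by nlinarith⟩
  · have hcos : cos a = cos b := by
      simp only [sin_sq_eq_half_sub, mul_div_cancel₀ _ (two_ne_zero' ℝ)] at hab
      linarith
    exact injOn_cos (Ioo_subset_Icc_self ha) (Ioo_subset_Icc_self hb) hcos
  · refine ⟨arccos (1 - 2 * x), ⟨?_, ?_⟩, ?_⟩
    · exact arccos_pos.2 (by linarith [hx.1])
    · refine (arccos_le_pi _).lt_of_ne fun h => ?_
      linarith [arccos_eq_pi.1 h, hx.2]
    · simp only [sin_sq_eq_half_sub, mul_div_cancel₀ _ (two_ne_zero' ℝ)]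
      rw [cos_arccos (by linarith [hx.2]) (by linarith [hx.1])]
      ring

theorem beta_half_eq_integral_sin_half_rpow {p : ℝ} (hp : -1 < p) :
    ProbabilityTheory.beta ((p + 1) / 2) (1 / 2) = ∫ θ in (0 : ℝ)..π, sin (θ / 2) ^ p := by
  have hderiv (θ : ℝ) :
      HasDerivAt (fun θ => sin (θ / 2) ^ 2) (sin (θ / 2) * cos (θ / 2)) θ :=
    (((hasDerivAt_id θ).div_const 2).sin.pow 2).congr_deriv (by simp; ring)
  rw [beta_eq_setIntegral (by linarith) (by norm_num), ← bijOn_sin_half_sq.image_eq,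
    MeasureTheory.integral_image_eq_integral_abs_deriv_smul measurableSet_Ioo
      (fun θ _ => (hderiv θ).hasDerivWithinAt) bijOn_sin_half_sq.injOn,
    intervalIntegral.integral_of_le pi_pos.le, MeasureTheory.integral_Ioc_eq_integral_Ioo]
  refine MeasureTheory.setIntegral_congr_fun measurableSet_Ioo fun θ hθ => ?_
  have hs := sin_half_pos hθ
  have hc := cos_half_pos hθ
  have hs_exp : ((2 : ℕ) : ℝ) * ((p + 1) / 2 - 1) = p - 1 := by push_cast; ring
  have hc_exp : ((2 : ℕ) : ℝ) * (1 / 2 - 1) = -1 := by norm_num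
  simp only [smul_eq_mul]
  rw [← cos_sq', ← rpow_natCast_mul hs.le, ← rpow_natCast_mul hc.le, abs_of_pos (by positivity),
    hs_exp, hc_exp, rpow_neg_one, rpow_sub_one hs.ne']
  field_simp

theorem norm_one_sub_exp_ofReal_mul_I (θ : ℝ) :
    ‖1 - Complex.exp (θ * Complex.I)‖ = 2 * |sin (θ / 2)| := by
  rw [norm_sub_rev, mul_comm, Complex.norm_exp_I_mul_ofReal_sub_one, norm_mul, Real.norm_ofNat,
    Real.norm_eq_abs]

theorem circleAverage_eq_integral_neg_pi_pi {E : Type*} [NormedAddCommGroup E] [NormedSpace ℝ E]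
    (f : ℂ → E) (r : ℝ) :
    circleAverage f 0 r = (2 * π)⁻¹ • ∫ θ in -π..π, f (r * Complex.exp (θ * Complex.I)) := by
  have hperiodic : (fun θ => f (circleMap 0 r θ)).Periodic (2 * π) :=
    (periodic_circleMap 0 r).comp f
  have h := hperiodic.intervalIntegral_add_eq 0 (-π)
  rw [zero_add, show -π + 2 * π = π by ring] at h
  rw [circleAverage, h]
  simp only [circleMap_zero]

theorem circleAverage_norm_one_sub_rpow {p : ℝ} (hp : 0 ≤ p) :
    circleAverage (fun z => ‖1 - z‖ ^ p) 0 1 =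
      2 ^ p / π * ProbabilityTheory.beta ((p + 1) / 2) (1 / 2) := by
  have hcont : Continuous fun θ : ℝ => (2 * |sin (θ / 2)|) ^ p :=
    Continuous.rpow_const (by fun_prop) fun _ => Or.inr hp
  have hright : ∫ θ in (0 : ℝ)..π, (2 * |sin (θ / 2)|) ^ p =
      2 ^ p * ProbabilityTheory.beta ((p + 1) / 2) (1 / 2) := by
    rw [beta_half_eq_integral_sin_half_rpow (by linarith), ← intervalIntegral.integral_const_mul]
    refine intervalIntegral.integral_congr fun θ hθ => ?_
    rw [uIcc_of_le pi_pos.le] at hθ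
    have hs : 0 ≤ sin (θ / 2) :=
      sin_nonneg_of_nonneg_of_le_pi (by linarith [hθ.1]) (by linarith [hθ.1, hθ.2])
    simp only [abs_of_nonneg hs, mul_rpow zero_le_two hs]
  have hleft : ∫ θ in -π..0, (2 * |sin (θ / 2)|) ^ p =
      ∫ θ in (0 : ℝ)..π, (2 * |sin (θ / 2)|) ^ p := by
    simpa [neg_div] using (intervalIntegral.integral_comp_neg (a := 0) (b := π)
      fun θ => (2 * |sin (θ / 2)|) ^ p).symm
  rw [circleAverage_eq_integral_neg_pi_pi]
  simp only [Complex.ofReal_one, one_mul, norm_one_sub_exp_ofReal_mul_I, smul_eq_mul]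
  rw [← intervalIntegral.integral_add_adjacent_intervals (hcont.intervalIntegrable _ 0)
    (hcont.intervalIntegrable 0 _), hleft, hright]
  field_simp
  ring

end BetaIntegral

section IntegralMeans

open Metric Real

theorem integralMean_eq_circleAverage (β r : ℝ) (h : ℂ → ℂ) :
    integralMean β r h = circleAverage (fun z => 1 / ‖deriv h z‖ ^ (2 * β)) 0 r := by
  rw [circleAverage_eq_integral_neg_pi_pi, smul_eq_mul, ← one_div]
  rfl

theorem integralMean_eq_of_norm_deriv_eq {h ω : ℂ → ℂ} {c r : ℝ}
    (hω : ∀ z ∈ ball (0 : ℂ) 1, ‖deriv h z‖ = ‖1 - ω z‖ ^ (-c)) (β : ℝ) (hr : |r| < 1) :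
    integralMean β r h = circleAverage (fun z => ‖1 - ω z‖ ^ (2 * β * c)) 0 r := by
  rw [integralMean_eq_circleAverage]
  refine circleAverage_congr_sphere fun z hz => ?_
  have hz1 : z ∈ ball (0 : ℂ) 1 :=
    closedBall_subset_ball hr (sphere_subset_closedBall hz)
  simp only [hω z hz1]
  rw [← rpow_mul (norm_nonneg _), one_div, ← rpow_neg (norm_nonneg _)]
  congr 1
  ring

theorem intervalIntegrable_meanIntegrand {α r : ℝ} {h : ℂ → ℂ} (hh : h ∈ classK α) (β : ℝ)
    (hr : |r| < 1) (a b : ℝ) :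
    IntervalIntegrable (meanIntegrand β r h) MeasureTheory.volume a b := by
  have hcircle : ∀ θ : ℝ, r * Complex.exp (θ * Complex.I) ∈ ball (0 : ℂ) 1 := fun θ => by
    simpa [Complex.norm_exp_ofReal_mul_I] using hr
  have hderiv_pos : ∀ θ : ℝ, 0 < ‖deriv h (r * Complex.exp (θ * Complex.I))‖ := fun θ =>
    norm_pos_iff.2 (hh.2 _ (hcircle θ)).1
  have hderiv_cont : Continuous fun θ : ℝ => deriv h (r * Complex.exp (θ * Complex.I)) :=
    hh.1.1.deriv.continuousOn.comp_continuous (by fun_prop) hcircle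
  exact (continuous_const.div (hderiv_cont.norm.rpow_const fun θ => Or.inl (hderiv_pos θ).ne')
    fun θ => (rpow_pos_of_pos (hderiv_pos θ) _).ne').intervalIntegrable a b

theorem integralMean_le_of_mem_classK {α β r : ℝ} {h : ℂ → ℂ} (hh : h ∈ classK α) (hβ : 0 < β)
    (hr : |r| < 1) :
    integralMean β r h ≤ 2 ^ (4 * β * (1 - α)) / π *
      ProbabilityTheory.beta ((4 * β * (1 - α) + 1) / 2) (1 / 2) := by
  obtain ⟨ω, hω, hderiv⟩ := exists_isSchwarzFunction_norm_deriv_eq hh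
  have hp : 0 < 4 * β * (1 - α) := by
    have := sub_pos.2 (lt_one_of_mem_classK hh)
    positivity
  have hexp : 2 * β * (2 * (1 - α)) = 4 * β * (1 - α) := by ring
  rw [integralMean_eq_of_norm_deriv_eq hderiv β hr, hexp, ← circleAverage_norm_one_sub_rpow hp.le]
  exact hω.circleAverage_norm_one_sub_rpow_le hp hr

theorem integralMean_le_sharpConst {β r : ℝ} {h : ℂ → ℂ} (hh : h ∈ classF) (hβ : 0 < β)
    (hr : |r| < 1) : integralMean β r h ≤ sharpConst β := by
  have hexp : 4 * β * (1 - -1 / 2) = 6 * β := by ring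
  simpa only [sharpConst, hexp] using integralMean_le_of_mem_classK hh hβ hr

end IntegralMeans

section ExtremalFunction

open Metric Real

theorem one_sub_ne_zero_of_mem_ball {z : ℂ} (hz : z ∈ ball (0 : ℂ) 1) : 1 - z ≠ 0 := by
  intro h
  simp [← sub_eq_zero.1 h] at hz

theorem hasDerivAt_extremalFun {z : ℂ} (hz : 1 - z ≠ 0) :
    HasDerivAt extremalFun (1 / (1 - z) ^ 3) z := by
  have h := ((hasDerivAt_id z).sub (((hasDerivAt_id z).pow 2).div_const 2)).div
    (((hasDerivAt_id z).const_sub 1).pow 2) (pow_ne_zero 2 hz)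
  refine h.congr_deriv ?_
  simp only [id, Pi.pow_apply, Pi.sub_apply]
  field_simp
  ring

theorem deriv_extremalFun {z : ℂ} (hz : 1 - z ≠ 0) : deriv extremalFun z = 1 / (1 - z) ^ 3 :=
  (hasDerivAt_extremalFun hz).deriv

theorem deriv_deriv_extremalFun {z : ℂ} (hz : 1 - z ≠ 0) :
    deriv (deriv extremalFun) z = 3 / (1 - z) ^ 4 := by
  have hev : deriv extremalFun =ᶠ[𝓝 z] fun w => ((1 - w) ^ 3)⁻¹ := by
    have hne : ∀ᶠ w in 𝓝 z, 1 - w ≠ 0 := ContinuousAt.eventually_ne (by fun_prop) hz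
    filter_upwards [hne] with w hw
    rw [deriv_extremalFun hw, one_div]
  have hinv := (((hasDerivAt_id z).const_sub 1).pow 3).fun_inv (pow_ne_zero 3 hz)
  rw [hev.deriv_eq]
  refine (hinv.congr_deriv ?_).deriv
  simp only [id, Pi.pow_apply]
  field_simp
  push_cast
  ring

theorem extremalFun_mem_classA : extremalFun ∈ classA := by
  have hdiff : DifferentiableOn ℂ extremalFun (ball 0 1) := fun z hz =>
    (hasDerivAt_extremalFun
      (one_sub_ne_zero_of_mem_ball hz)).differentiableAt.differentiableWithinAt
  exact ⟨hdiff.analyticOnNhd isOpen_ball, by simp [extremalFun], by simp [deriv_extremalFun]⟩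

theorem extremalFun_mem_classF : extremalFun ∈ classF := by
  refine ⟨extremalFun_mem_classA, fun z hz => ?_⟩
  have hne := one_sub_ne_zero_of_mem_ball hz
  have hquot : z * (3 / (1 - z) ^ 4) / (1 / (1 - z) ^ 3) = ((3 : ℝ) : ℂ) * (z / (1 - z)) := by
    push_cast
    field_simp
  have hz1 : ‖z‖ < 1 := by simpa using hz
  have hpos : 0 < (1 - ‖z‖ ^ 2) / (2 * ‖1 - z‖ ^ 2) := by
    have : 0 < ‖1 - z‖ := norm_pos_iff.2 hne
    have : 0 < 1 - ‖z‖ ^ 2 := by nlinarith [norm_nonneg z]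
    positivity
  rw [deriv_deriv_extremalFun hne, deriv_extremalFun hne, hquot, Complex.add_re, Complex.one_re,
    Complex.re_ofReal_mul, re_div_one_sub (sub_ne_zero.1 hne).symm]
  exact ⟨div_ne_zero one_ne_zero (pow_ne_zero 3 hne), by linarith⟩

theorem extremalFun_mem_classS : extremalFun ∈ classS := by
  refine ⟨extremalFun_mem_classA, fun z hz w hw h => ?_⟩
  have hz0 := one_sub_ne_zero_of_mem_ball hz
  have hw0 := one_sub_ne_zero_of_mem_ball hw
  have hfactor : (z - w) * (2 - z - w) = 0 := by
    simp only [extremalFun] at h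
    rw [div_eq_div_iff (pow_ne_zero 2 hz0) (pow_ne_zero 2 hw0)] at h
    linear_combination 2 * h
  rcases mul_eq_zero.1 hfactor with hzw | hsum
  · exact sub_eq_zero.1 hzw
  · have hre := congrArg Complex.re hsum
    have hz1 := (Complex.re_le_norm z).trans_lt (by simpa using hz)
    have hw1 := (Complex.re_le_norm w).trans_lt (by simpa using hw)
    simp only [Complex.sub_re, Complex.re_ofNat, Complex.zero_re] at hre
    linarith

theorem integralMean_extremalFun (β : ℝ) {r : ℝ} (hr : |r| < 1) :
    integralMean β r extremalFun = circleAverage (fun z => ‖1 - z‖ ^ (6 * β)) 0 r := by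
  have hderiv : ∀ z ∈ ball (0 : ℂ) 1, ‖deriv extremalFun z‖ = ‖1 - z‖ ^ (-3 : ℝ) := fun z hz => by
    rw [deriv_extremalFun (one_sub_ne_zero_of_mem_ball hz), norm_div, norm_one, norm_pow, one_div,
      rpow_neg (norm_nonneg _)]
    norm_cast
  have hexp : 2 * β * 3 = 6 * β := by ring
  rw [integralMean_eq_of_norm_deriv_eq hderiv β hr, hexp]

theorem tendsto_integralMean_extremalFun {β : ℝ} (hβ : 0 ≤ β) :
    Tendsto (fun r : ℝ => integralMean β r extremalFun) (𝓝[<] 1) (𝓝 (sharpConst β)) := by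
  have hcont : Continuous fun z : ℂ => ‖1 - z‖ ^ (6 * β) :=
    Continuous.rpow_const (by fun_prop) fun _ => Or.inr (by positivity)
  have h := (Continuous.circleAverage hcont (c := 0)).tendsto 1
  rw [circleAverage_norm_one_sub_rpow (by positivity)] at h
  refine (h.mono_left nhdsWithin_le_nhds).congr' ?_
  filter_upwards [Ioo_mem_nhdsLT (neg_lt_self one_pos)] with r hr
  exact (integralMean_extremalFun β (abs_lt.2 hr)).symm

end ExtremalFunction

theorem mainTheorem1 :
    -- the inequality, for every function of the class
    (∀ h ∈ classF, ∀ β : ℝ, 0 < β → ∀ r ∈ Set.Ioo (0 : ℝ) 1,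
      IntervalIntegrable (meanIntegrand β r h) MeasureTheory.volume (-Real.pi) Real.pi ∧
      integralMean β r h ≤ sharpConst β) ∧
    -- sharpness: for every `β` the constant is the least upper bound of the integral means
    (∀ β : ℝ, 0 < β →
      IsLUB {I : ℝ | ∃ h ∈ classF, ∃ r ∈ Set.Ioo (0 : ℝ) 1, I = integralMean β r h}
        (sharpConst β)) ∧
    -- it is approached, as `r → 1`, by the univalent function `h₀`, where `h₀' = (1 - z)⁻³`
    (extremalFun ∈ classF ∧ extremalFun ∈ classS ∧
      (∀ z ∈ Metric.ball (0 : ℂ) 1, deriv extremalFun z = 1 / (1 - z) ^ 3) ∧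
      ∀ β : ℝ, 0 < β →
        Tendsto (fun r : ℝ => integralMean β r extremalFun) (𝓝[<] 1) (𝓝 (sharpConst β))) := by
  have abs_lt_one {r : ℝ} (hr : r ∈ Set.Ioo (0 : ℝ) 1) : |r| < 1 := by
    rw [abs_of_pos hr.1]
    exact hr.2
  refine ⟨fun h hh β hβ r hr => ⟨intervalIntegrable_meanIntegrand hh β (abs_lt_one hr) _ _,
      integralMean_le_sharpConst hh hβ (abs_lt_one hr)⟩,
    fun β hβ => ⟨?_, fun b hb => ?_⟩,
    extremalFun_mem_classF, extremalFun_mem_classS,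
    fun z hz => deriv_extremalFun (one_sub_ne_zero_of_mem_ball hz),
    fun β hβ => tendsto_integralMean_extremalFun hβ.le⟩
  · rintro _ ⟨h, hh, r, hr, rfl⟩
    exact integralMean_le_sharpConst hh hβ (abs_lt_one hr)
  · refine le_of_tendsto (tendsto_integralMean_extremalFun hβ.le) ?_
    filter_upwards [Ioo_mem_nhdsLT one_pos] with r hr
    exact hb ⟨extremalFun, extremalFun_mem_classF, r, hr, rfl⟩
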